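/- For $n\ge 3$ let $T_n=\langle s_1,\dots,s_{n-1}\mid s_k^2=1\ (1\le k\le n-1),\ s_is_j=s_js_i\ (|i-j|\ge 2)\rangle$ be the twin group, let $T_n'=[T_n,T_n]$ and $T_n''=[T_n',T_n']$, and let $\mathbb Z_2^{n-1}$ be generated by its standard basis $a_1,\dots,a_{n-1}$. Put $\beta_0(j)=s_{j+1}s_js_{j+1}s_j$ for $1\le j\le n-2$ and $\beta_1(j)=s_{j-1}\,\beta_0(j)\,s_{j-1}$ for $2\le j\le n-2$. Denote the classes of these elements in $T_n'/T_n''$ by the same symbols. Then the following hold. (1) There is a short exact sequence $$1\to T_n'/T_n''\to T_n/T_n''\xrightarrow{\ \pi\ }\mathbb Z_2^{n-1}\to 1,$$ where the first map is induced by inclusion and $\pi(s_k)=a_k$. The group $T_n'/T_n''\cong\mathbb Z^{2n-5}$ is free abelian with basis $\beta_0(j)$ $(1\le j\le n-2)$, $\beta_1(j)$ $(2\le j\le n-2)$. (2) Conjugation in $T_n/T_n''$ induces a homomorphism $\Theta:\mathbb Z_2^{n-1}\to\operatorname{Aut}(T_n'/T_n'')$, $\Theta(\pi(z))(x)=zxz^{-1}$,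 given for $1\le k\le n-1$ and all $j$ for which the argument is defined by $$\Theta(a_k)(\beta_0(j))=\begin{cases}\beta_0(j+1)\beta_0(j)\beta_1(j+1)^{-1}& j=k-2,\\ \beta_0(j)^{-1}& j\in\{k-1,k\},\\ \beta_1(j)& j=k+1,\\ \beta_0(j)&\text{otherwise,}\end{cases}\qquad \Theta(a_k)(\beta_1(j))=\begin{cases}\beta_0(j+1)\beta_1(j)\beta_1(j+1)^{-1}& j=k-2,\\ \beta_1(j)^{-1}& j\in\{k-1,k\},\\ \beta_0(j)& j=k+1,\\ \beta_1(j)&\text{otherwise.}\end{cases}$$ The homomorphism $\Theta$ is faithful if and only if $n\ge 4$; so for $n\ge4$ it is the holonomy representation of $T_n/T_n''$ and the holonomy group is $\mathbb Z_2^{n-1}$. (3) $T_n/T_n''$ is a crystallographic group of dimension $2n-5$, i.e. it is isomorphic to a discrete uniform (closed and cocompact) subgroup of $\mathbb R^{2n-5}\rtimes \mathrm O(2n-5,\mathbb R)$. (4) $T_n/T_n''$ is not a Bieberbach group (a torsion-free crystallographic group) of any dimension. It has elements of order $2$, and every nontrivial element of finite order has order $2$. -/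

import Mathlib

open scoped commutatorElement

/-! ### Twin groups -/

/-- Indices `1, …, n - 1` of the standard generators of the twin group on `n` strands. -/
abbrev TwinIndex (n : ℕ) : Type := {k : ℕ // 1 ≤ k ∧ k < n}

/-- Defining relators of the twin group: `s_k ^ 2`, and `(s_i s_j) (s_j s_i)⁻¹` for
`|i - j| ≥ 2`. -/
def twinRelators (n : ℕ) : Set (FreeGroup (TwinIndex n)) :=
  {r | ∃ k : TwinIndex n, r = FreeGroup.of k ^ 2} ∪
  {r | ∃ i j : TwinIndex n, (i.1 + 2 ≤ j.1 ∨ j.1 + 2 ≤ i.1) ∧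
    r = (FreeGroup.of i * FreeGroup.of j) * (FreeGroup.of j * FreeGroup.of i)⁻¹}

/-- The twin group `T_n`. -/
abbrev TwinGroup (n : ℕ) : Type := PresentedGroup (twinRelators n)

/-- The generator `s_k` of `T_n`, with the convention `s_k = 1` outside `1 ≤ k ≤ n - 1`. -/
def twinGen (n k : ℕ) : TwinGroup n :=
  if h : 1 ≤ k ∧ k < n then PresentedGroup.of ⟨k, h⟩ else 1

theorem twinGen_mul_self (n k : ℕ) : twinGen n k * twinGen n k = 1 := by
  unfold twinGen
  split_ifs with h
  · rw [← pow_two]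
    exact PresentedGroup.one_of_mem (rels := twinRelators n)
      (x := FreeGroup.of (⟨k, h⟩ : TwinIndex n) ^ 2) (Or.inl ⟨⟨k, h⟩, rfl⟩)
  · simp

theorem twinGen_inv (n k : ℕ) : (twinGen n k)⁻¹ = twinGen n k :=
  inv_eq_of_mul_eq_one_right (twinGen_mul_self n k)

/-- `β₀(j) = s_{j+1} s_j s_{j+1} s_j`. -/
def twinBetaZero (n j : ℕ) : TwinGroup n :=
  twinGen n (j + 1) * twinGen n j * twinGen n (j + 1) * twinGen n j

/-- `β₁(j) = s_{j-1} (s_{j+1} s_j s_{j+1} s_j) s_{j-1}`, used for `2 ≤ j`. -/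
def twinBetaOne (n j : ℕ) : TwinGroup n :=
  twinGen n (j - 1) * twinBetaZero n j * twinGen n (j - 1)

theorem twinBetaZero_mem (n j : ℕ) : twinBetaZero n j ∈ commutator (TwinGroup n) := by
  have h : twinBetaZero n j = ⁅twinGen n (j + 1), twinGen n j⁆ := by
    rw [commutatorElement_def, twinGen_inv, twinGen_inv, twinBetaZero]
  rw [h]
  exact Subgroup.commutator_mem_commutator (Subgroup.mem_top _) (Subgroup.mem_top _)

theorem twinBetaOne_mem (n j : ℕ) : twinBetaOne n j ∈ commutator (TwinGroup n) := by
  have h := Subgroup.Normal.conj_mem (inferInstance : (commutator (TwinGroup n)).Normal) _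
    (twinBetaZero_mem n j) (twinGen n (j - 1))
  rwa [twinGen_inv] at h

/-! ### The quotients `T_n / T_n''` and `T_n' / T_n''` -/

/-- `T_n / T_n''`, where `T_n''` is the second term of the derived series. -/
abbrev TwinModSecond (n : ℕ) : Type := TwinGroup n ⧸ derivedSeries (TwinGroup n) 2

/-- `T_n' / T_n''`, that is, the derived subgroup `T_n'` modulo its own derived subgroup. -/
abbrev TwinDerivedMod (n : ℕ) : Type := Abelianization (commutator (TwinGroup n))

theorem commutator_commutator_le_comap (G : Type*) [Group G] :
    commutator (commutator G) ≤ (derivedSeries G 2).comap (commutator G).subtype := by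
  rw [← Subgroup.map_le_iff_le_comap, commutator_def (commutator G), Subgroup.map_commutator,
    ← MonoidHom.range_eq_map, Subgroup.range_subtype]
  exact le_of_eq rfl

/-- The homomorphism `T_n' / T_n'' → T_n / T_n''` induced by the inclusion `T_n' ⊆ T_n`. -/
def twinInclusion (n : ℕ) : TwinDerivedMod n →* TwinModSecond n :=
  QuotientGroup.map (commutator (commutator (TwinGroup n))) (derivedSeries (TwinGroup n) 2)
    (commutator (TwinGroup n)).subtype (commutator_commutator_le_comap (TwinGroup n))

/-- The class of `β₀(j)` in `T_n' / T_n''`. -/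
def twinB0 (n j : ℕ) : TwinDerivedMod n :=
  Abelianization.of ⟨twinBetaZero n j, twinBetaZero_mem n j⟩

/-- The class of `β₁(j)` in `T_n' / T_n''`. -/
def twinB1 (n j : ℕ) : TwinDerivedMod n :=
  Abelianization.of ⟨twinBetaOne n j, twinBetaOne_mem n j⟩

/-- The elementary abelian group `ℤ₂^{n-1}`, written multiplicatively, with one coordinate for each
of the indices `1, …, n - 1`. -/
abbrev TwinElemAb (n : ℕ) : Type := Multiplicative (TwinIndex n → ZMod 2)

/-- The standard generator `a_k` of `ℤ₂^{n-1}`. -/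
def twinA (n : ℕ) (k : TwinIndex n) : TwinElemAb n := Multiplicative.ofAdd (Pi.single k 1)

/-! ### Crystallographic and Bieberbach groups -/

/-- The action of the orthogonal group `O(d, ℝ)` on `ℝ^d` by matrix multiplication. -/
def orthogonalAction (d : ℕ) :
    Matrix.orthogonalGroup (Fin d) ℝ →* MulAut (Multiplicative (Fin d → ℝ)) where
  toFun A :=
    { toFun := fun v => Multiplicative.ofAdd (Matrix.mulVec A.1 v.toAdd)
      invFun := fun v => Multiplicative.ofAdd (Matrix.mulVec (A⁻¹).1 v.toAdd)
      left_inv := fun v => by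
        have h : (A⁻¹).1 * A.1 = 1 := congrArg Subtype.val (inv_mul_cancel A)
        simp only [toAdd_ofAdd, Matrix.mulVec_mulVec, h, Matrix.one_mulVec, ofAdd_toAdd]
      right_inv := fun v => by
        have h : A.1 * (A⁻¹).1 = 1 := congrArg Subtype.val (mul_inv_cancel A)
        simp only [toAdd_ofAdd, Matrix.mulVec_mulVec, h, Matrix.one_mulVec, ofAdd_toAdd]
      map_mul' := fun v w => by
        simp only [toAdd_mul, Matrix.mulVec_add, ofAdd_add] }
  map_one' := by
    ext v : 1
    simp
  map_mul' A B := by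
    ext v : 1
    simp [Matrix.mulVec_mulVec]

/-- The group `ℝ^d ⋊ O(d, ℝ)`. -/
abbrev EuclideanMotion (d : ℕ) : Type :=
  Multiplicative (Fin d → ℝ) ⋊[orthogonalAction d] Matrix.orthogonalGroup (Fin d) ℝ

/-- The topology of `ℝ^d ⋊ O(d, ℝ)` is the product topology of `ℝ^d × O(d, ℝ)`. -/
instance euclideanMotionTopology (d : ℕ) : TopologicalSpace (EuclideanMotion d) :=
  TopologicalSpace.induced (fun g => (g.left, g.right)) inferInstance

theorem continuous_euclideanMotion_left (d : ℕ) :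
    Continuous (fun g : EuclideanMotion d => g.left) :=
  continuous_fst.comp
    (continuous_induced_dom (f := fun g : EuclideanMotion d => (g.left, g.right)))

theorem continuous_euclideanMotion_right (d : ℕ) :
    Continuous (fun g : EuclideanMotion d => g.right) :=
  continuous_snd.comp
    (continuous_induced_dom (f := fun g : EuclideanMotion d => (g.left, g.right)))

instance euclideanMotion_t2Space (d : ℕ) : T2Space (EuclideanMotion d) :=
  T2Space.of_injective_continuous (f := fun g : EuclideanMotion d => (g.left, g.right))
    (fun _ _ e => SemidirectProduct.ext (congrArg Prod.fst e) (congrArg Prod.snd e))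
    continuous_induced_dom

theorem continuous_orthogonalAction (d : ℕ) :
    Continuous (fun p : Matrix.orthogonalGroup (Fin d) ℝ × Multiplicative (Fin d → ℝ) =>
      orthogonalAction d p.1 p.2) :=
  continuous_ofAdd.comp
    ((continuous_subtype_val.comp continuous_fst).matrix_mulVec
      (continuous_toAdd.comp continuous_snd))

instance euclideanMotion_isTopologicalGroup (d : ℕ) : IsTopologicalGroup (EuclideanMotion d) where
  continuous_mul := by
    refine continuous_induced_rng.2 (Continuous.prodMk ?_ ?_)
    · exact ((continuous_euclideanMotion_left d).comp continuous_fst).mul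
        ((continuous_orthogonalAction d).comp
          (((continuous_euclideanMotion_right d).comp continuous_fst).prodMk
            ((continuous_euclideanMotion_left d).comp continuous_snd)))
    · exact ((continuous_euclideanMotion_right d).comp continuous_fst).mul
        ((continuous_euclideanMotion_right d).comp continuous_snd)
  continuous_inv := by
    have hr : Continuous (fun g : EuclideanMotion d => g.right⁻¹) :=
      Continuous.subtype_mk
        (Continuous.star (continuous_subtype_val.comp (continuous_euclideanMotion_right d))) _
    refine continuous_induced_rng.2 (Continuous.prodMk ?_ hr)
    exact (continuous_orthogonalAction d).comp
      (hr.prodMk (continuous_euclideanMotion_left d).inv)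

/-- A closed subgroup `H` of a topological group `G` is uniform if `G / H` is compact. -/
def IsUniformSubgroup {G : Type*} [Group G] [TopologicalSpace G] (H : Subgroup G) : Prop :=
  IsClosed (H : Set G) ∧ CompactSpace (G ⧸ H)

/-- `G` is a crystallographic group of dimension `d`: it is isomorphic to a discrete uniform
subgroup of `ℝ^d ⋊ O(d, ℝ)`. -/
def IsCrystallographicGroup (d : ℕ) (G : Type*) [Group G] : Prop :=
  ∃ Γ : Subgroup (EuclideanMotion d),
    DiscreteTopology Γ ∧ IsUniformSubgroup Γ ∧ Nonempty (G ≃* Γ)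

/-- `G` is a Bieberbach group of dimension `d`: a torsion-free crystallographic group of
dimension `d`. -/
def IsBieberbachGroup (d : ℕ) (G : Type*) [Group G] : Prop :=
  IsCrystallographicGroup d G ∧ ∀ g : G, IsOfFinOrder g → g = 1

/-! Everything is read off from homomorphisms of `T_n` to the group `ℤ ⋊ {±1}` of motions of the
integer line, one for each of the `2n - 5` expected basis elements. Write r₀ for x ↦ -x and r₁ for x
↦ 1 - x. The homomorphism X_j (index `Sum.inl j`) sends s_j to r₀ and s_{j+1} to r₁; Y_j (index
`Sum.inr j`) sends s_{j-1} and s_{j+1} to r₀ and s_j to r₁; all other generators go to 1. On T_n'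
the sign is trivial, so the translation part is an integer linear form on T_n'/T_n'', again called
X_j or Y_j.

Spanning: the table of the conjugation action on the β's (`conj_twinB0`, `conj_twinB1`) shows that
the subgroup they generate is stable under T_n. Its preimage in T_n is therefore normal, and it
contains the commutators of generators, so it is all of T_n' (`closure_twinB`). Independence:
explicit combinations of the X_j, Y_j are four times the dual basis (`twinDual_twinB`).

In the coordinates X_j, Y_j conjugation acts by diagonal signs (`twinCoord_conj`). Faithfulness of
the holonomy is thus a small linear system over `ZMod 2` for the exponents of the generators
(`twinHolonomy_injective`). Jointly the homomorphisms have kernel exactly T_n''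
(`mem_derivedSeries_two_of_twinLine`), and the image of T_n' contains 4ℤ^{2n-5}
(`exists_twinForm_eq`). Hence T_n/T_n'' embeds in (ℤ ⋊ {±1})^{2n-5}, a discrete group of euclidean
motions with diagonal linear parts, and contains a full lattice: it is crystallographic. For the
torsion, the square of any element lies in the torsion-free group T_n'/T_n'', and each s_k survives
as an involution. -/

/-! ### The conjugation action on the abelianized derived subgroup -/

/-- The action of `G` by conjugation on the abelianization of its derived subgroup. -/
def conjDerived (G : Type*) [Group G] : G →* MulAut (Abelianization (commutator G)) where
  toFun g := (MulAut.conjNormal g : MulAut (commutator G)).abelianizationCongr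
  map_one' := by
    ext x
    induction x using QuotientGroup.induction_on with
    | H x =>
      change Abelianization.of _ = Abelianization.of _
      simp
  map_mul' g h := by
    ext x
    induction x using QuotientGroup.induction_on with
    | H x =>
      change Abelianization.of _ = Abelianization.of _
      simp

theorem conjDerived_of {G : Type*} [Group G] (g : G) (x : commutator G) :
    conjDerived G g (Abelianization.of x) = Abelianization.of (MulAut.conjNormal g x) := rfl

/-- Conjugation by an element of G' is an inner automorphism of G', hence trivial on its
abelianization. So the action factors through the abelianization of G, and any two of its operators
commute. -/
theorem conjDerived_eq_one {G : Type*} [Group G] {g : G} (hg : g ∈ commutator G) :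
    conjDerived G g = 1 := by
  ext x
  induction x using QuotientGroup.induction_on with
  | H x =>
    have h : MulAut.conjNormal g x = ⟨g, hg⟩ * x * (⟨g, hg⟩ : commutator G)⁻¹ := by
      ext; simp
    change Abelianization.of (MulAut.conjNormal g x) = Abelianization.of x
    rw [h, map_mul, map_mul, map_inv, mul_comm, inv_mul_cancel_left]

theorem conjDerived_commute {G : Type*} [Group G] (g h : G) :
    Commute (conjDerived G g) (conjDerived G h) := by
  rw [← commutatorElement_eq_one_iff_commute, ← map_commutatorElement]
  exact conjDerived_eq_one
    (Subgroup.commutator_mem_commutator (Subgroup.mem_top _) (Subgroup.mem_top _))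

theorem conjDerived_apply_comm {G : Type*} [Group G] (g h : G)
    (x : Abelianization (commutator G)) :
    conjDerived G g (conjDerived G h x) = conjDerived G h (conjDerived G g x) :=
  DFunLike.congr_fun (conjDerived_commute g h) x

/-! ### Homomorphisms out of the twin group -/

theorem twinGen_of_index {n : ℕ} (k : TwinIndex n) : twinGen n k = PresentedGroup.of k :=
  dif_pos k.2

theorem twinGen_eq_one {n k : ℕ} (h : ¬ (1 ≤ k ∧ k < n)) : twinGen n k = 1 := dif_neg h

theorem twinGen_comm {n i j : ℕ} (h : i + 2 ≤ j ∨ j + 2 ≤ i) :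
    twinGen n i * twinGen n j = twinGen n j * twinGen n i := by
  by_cases hi : 1 ≤ i ∧ i < n
  · by_cases hj : 1 ≤ j ∧ j < n
    · rw [twinGen, twinGen, dif_pos hi, dif_pos hj]
      exact PresentedGroup.mk_eq_mk_of_mul_inv_mem (rels := twinRelators n)
        (x := FreeGroup.of (⟨i, hi⟩ : TwinIndex n) * FreeGroup.of ⟨j, hj⟩)
        (y := FreeGroup.of (⟨j, hj⟩ : TwinIndex n) * FreeGroup.of ⟨i, hi⟩)
        (Or.inr ⟨⟨i, hi⟩, ⟨j, hj⟩, h, rfl⟩)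
    · simp [twinGen_eq_one hj]
  · simp [twinGen_eq_one hi]

/-- The homomorphism out of the twin group prescribed on generators. -/
def twinLift (n : ℕ) {G : Type*} [Group G] (f : ℕ → G) (hf : ∀ k, f k * f k = 1)
    (hc : ∀ i j, i + 2 ≤ j → Commute (f i) (f j)) : TwinGroup n →* G :=
  PresentedGroup.toGroup (f := fun k : TwinIndex n => f k) (by
    rintro r (⟨k, rfl⟩ | ⟨i, j, h, rfl⟩)
    · simp [pow_two, hf]
    · simp only [map_mul, map_inv, FreeGroup.lift_apply_of, mul_inv_eq_one]
      rcases h with h | h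
      · exact hc _ _ h
      · exact (hc _ _ h).symm)

theorem twinLift_gen {n : ℕ} {G : Type*} [Group G] (f : ℕ → G) (hf : ∀ k, f k * f k = 1)
    (hc : ∀ i j, i + 2 ≤ j → Commute (f i) (f j)) (k : ℕ) :
    twinLift n f hf hc (twinGen n k) = if 1 ≤ k ∧ k < n then f k else 1 := by
  unfold twinGen
  split_ifs with h
  · exact PresentedGroup.toGroup.of _
  · exact map_one _

theorem twin_hom_ext {n : ℕ} {G : Type*} [Group G] {f g : TwinGroup n →* G}
    (h : ∀ k : TwinIndex n, f (twinGen n k) = g (twinGen n k)) : f = g :=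
  PresentedGroup.ext fun k => by simpa only [twinGen_of_index] using h k

theorem twin_closure (n : ℕ) :
    Subgroup.closure (Set.range fun k : TwinIndex n => twinGen n k) = ⊤ := by
  simpa only [twinGen_of_index] using PresentedGroup.closure_range_of (twinRelators n)

/-! ### The action of the generators on `T_n' / T_n''` -/

theorem twinGen_mul_self_assoc (n k : ℕ) (x : TwinGroup n) :
    twinGen n k * (twinGen n k * x) = x := by
  rw [← mul_assoc, twinGen_mul_self, one_mul]

theorem conj_twinB0_self (n j : ℕ) :
    conjDerived _ (twinGen n j) (twinB0 n j) = (twinB0 n j)⁻¹ := by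
  rw [twinB0, conjDerived_of, ← map_inv]
  congr 1
  ext
  simp [twinBetaZero, twinGen_inv, mul_assoc, twinGen_mul_self]

theorem conj_twinB0_succ (n j : ℕ) :
    conjDerived _ (twinGen n (j + 1)) (twinB0 n j) = (twinB0 n j)⁻¹ := by
  rw [twinB0, conjDerived_of, ← map_inv]
  congr 1
  ext
  simp [twinBetaZero, twinGen_inv, mul_assoc, twinGen_mul_self_assoc]

theorem conj_twinB0_pred (n j : ℕ) :
    conjDerived _ (twinGen n (j - 1)) (twinB0 n j) = twinB1 n j := by
  rw [twinB0, conjDerived_of, twinB1]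
  congr 1
  ext
  simp [twinBetaOne, twinGen_inv]

/-- The identity already holds in T_n: after expanding, s_j is moved past s_{j+2} and squares of
generators cancel. -/
theorem conj_twinB0_add_two (n j : ℕ) :
    conjDerived _ (twinGen n (j + 2)) (twinB0 n j) =
      twinB0 n (j + 1) * twinB0 n j * (twinB1 n (j + 1))⁻¹ := by
  rw [twinB0, conjDerived_of, twinB0, twinB1, ← map_mul, ← map_inv, ← map_mul]
  congr 1
  ext
  have h := twinGen_comm (n := n) (i := j) (j := j + 2) (Or.inl le_rfl)
  have h' : ∀ x, twinGen n j * (twinGen n (j + 2) * x) = twinGen n (j + 2) * (twinGen n j * x) :=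
    fun x => by rw [← mul_assoc, h, mul_assoc]
  simp [twinBetaZero, twinBetaOne, twinGen_inv, mul_assoc, twinGen_mul_self_assoc, h, h']

theorem conj_twinB0_far (n : ℕ) {j k : ℕ} (h : k + 2 ≤ j ∨ j + 3 ≤ k) :
    conjDerived _ (twinGen n k) (twinB0 n j) = twinB0 n j := by
  rw [twinB0, conjDerived_of]
  congr 1
  ext
  have h1 : Commute (twinGen n k) (twinGen n j) := twinGen_comm (by lia)
  have h2 : Commute (twinGen n k) (twinGen n (j + 1)) := twinGen_comm (by lia)
  have h3 : Commute (twinGen n k) (twinBetaZero n j) :=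
    ((h2.mul_right h1).mul_right h2).mul_right h1
  simp [h3.eq]

theorem conj_twinB1_pred (n j : ℕ) :
    conjDerived _ (twinGen n (j - 1)) (twinB1 n j) = twinB0 n j := by
  rw [← conj_twinB0_pred, ← MulAut.mul_apply, ← map_mul, twinGen_mul_self, map_one,
    MulAut.one_apply]

/-- Since β₁(j) is the image of β₀(j) under s_{j-1} and the operators commute, the table for β₁ is
obtained by applying s_{j-1} to the table for β₀. -/
theorem conj_twinB1_eq (n k j : ℕ) : conjDerived _ (twinGen n k) (twinB1 n j) =
    conjDerived _ (twinGen n (j - 1)) (conjDerived _ (twinGen n k) (twinB0 n j)) := by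
  rw [← conj_twinB0_pred, conjDerived_apply_comm]

theorem conj_twinB0 (n k j : ℕ) :
    conjDerived _ (twinGen n k) (twinB0 n j) =
      if j + 2 = k then twinB0 n (j + 1) * twinB0 n j * (twinB1 n (j + 1))⁻¹
      else if j + 1 = k ∨ j = k then (twinB0 n j)⁻¹
      else if j = k + 1 then twinB1 n j
      else twinB0 n j := by
  split_ifs with h1 h2 h3
  · subst h1; exact conj_twinB0_add_two n j
  · rcases h2 with rfl | rfl
    · exact conj_twinB0_succ n j
    · exact conj_twinB0_self n j
  · subst h3; exact conj_twinB0_pred n (k + 1)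
  · exact conj_twinB0_far n (by lia)

theorem conj_twinB1 (n k j : ℕ) (hj : 2 ≤ j) :
    conjDerived _ (twinGen n k) (twinB1 n j) =
      if j + 2 = k then twinB0 n (j + 1) * twinB1 n j * (twinB1 n (j + 1))⁻¹
      else if j + 1 = k ∨ j = k then (twinB1 n j)⁻¹
      else if j = k + 1 then twinB0 n j
      else twinB1 n j := by
  rw [conj_twinB1_eq, conj_twinB0]
  split_ifs with h1 h2 h3
  -- s_{j-1} is far from s_{j+1} and s_{j+2}, so it fixes β₀(j+1), and by commutation of operators
  -- also β₁(j+1); only the middle factor β₀(j) changes.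
  · have h := conj_twinB0_far n (k := j - 1) (j := j + 1) (by lia)
    rw [map_mul, map_mul, map_inv, conj_twinB1_eq n (j - 1) (j + 1), h, Nat.add_sub_cancel,
      conj_twinB0_pred]
    congr 2
    exact conj_twinB0_pred n (j + 1)
  · rw [map_inv, conj_twinB0_pred]
  · exact conj_twinB1_pred n j
  · exact conj_twinB0_pred n j

/-! ### Generators of `T_n' / T_n''` -/

/-- Indices of the classes `β₀(j)` and `β₁(j)`. -/
abbrev TwinBasisIndex (n : ℕ) : Type :=
  {j : ℕ // 1 ≤ j ∧ j + 2 ≤ n} ⊕ {j : ℕ // 2 ≤ j ∧ j + 2 ≤ n}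

/-- The family of the classes `β₀(j)` and `β₁(j)`. -/
def twinB (n : ℕ) : TwinBasisIndex n → TwinDerivedMod n :=
  Sum.elim (fun j => twinB0 n j) (fun j => twinB1 n j)

/-- The subgroup of a group `G` consisting of the elements of `G'` whose class modulo `G''` lies in
a given subgroup. -/
def derivedPreimage {G : Type*} [Group G] (S : Subgroup (Abelianization (commutator G))) :
    Subgroup G :=
  (S.comap Abelianization.of).map (commutator G).subtype

theorem mem_derivedPreimage {G : Type*} [Group G] {S : Subgroup (Abelianization (commutator G))}
    {g : G} : g ∈ derivedPreimage S ↔ ∃ h : g ∈ commutator G, Abelianization.of ⟨g, h⟩ ∈ S := by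
  simp [derivedPreimage]

theorem twinB0_mem {n j : ℕ} (h : 1 ≤ j ∧ j + 2 ≤ n) :
    twinB0 n j ∈ Subgroup.closure (Set.range (twinB n)) :=
  Subgroup.subset_closure ⟨Sum.inl ⟨j, h⟩, rfl⟩

theorem twinB1_mem {n j : ℕ} (h : 2 ≤ j ∧ j + 2 ≤ n) :
    twinB1 n j ∈ Subgroup.closure (Set.range (twinB n)) :=
  Subgroup.subset_closure ⟨Sum.inr ⟨j, h⟩, rfl⟩

/-- On generators the action table never leaves the index range: the term with j + 1 occurs only for
k = j + 2 < n, and the switch from β₀(j) to β₁(j) only for j = k + 1 ≥ 2. -/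
theorem conj_mem_closure_twinB (n : ℕ) (g : TwinGroup n) {x : TwinDerivedMod n}
    (hx : x ∈ Subgroup.closure (Set.range (twinB n))) :
    conjDerived _ g x ∈ Subgroup.closure (Set.range (twinB n)) := by
  have hgen : ∀ (k : TwinIndex n), ∀ y ∈ Subgroup.closure (Set.range (twinB n)),
      conjDerived _ (twinGen n k) y ∈ Subgroup.closure (Set.range (twinB n)) := by
    rintro ⟨k, hk⟩ y hy
    induction hy using Subgroup.closure_induction with
    | mem y hy =>
      obtain ⟨⟨j, hj⟩ | ⟨j, hj⟩, rfl⟩ := hy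
      · change conjDerived _ (twinGen n k) (twinB0 n j) ∈ _
        rw [conj_twinB0]
        split_ifs with h1 h2 h3
        · exact mul_mem (mul_mem (twinB0_mem (by lia)) (twinB0_mem hj))
            (inv_mem (twinB1_mem (by lia)))
        · exact inv_mem (twinB0_mem hj)
        · exact twinB1_mem (by lia)
        · exact twinB0_mem hj
      · change conjDerived _ (twinGen n k) (twinB1 n j) ∈ _
        rw [conj_twinB1 _ _ _ hj.1]
        split_ifs with h1 h2 h3
        · exact mul_mem (mul_mem (twinB0_mem (by lia)) (twinB1_mem hj))
            (inv_mem (twinB1_mem (by lia)))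
        · exact inv_mem (twinB1_mem hj)
        · exact twinB0_mem (by lia)
        · exact twinB1_mem hj
    | one => rw [map_one]; exact one_mem _
    | mul y z _ _ hy hz => rw [map_mul]; exact mul_mem hy hz
    | inv y _ hy => rw [map_inv]; exact inv_mem hy
  have hg : g ∈ Subgroup.closure (Set.range fun k : TwinIndex n => twinGen n k) := by
    rw [twin_closure]; trivial
  induction hg using Subgroup.closure_induction'' generalizing x with
  | mem g hg => obtain ⟨k, rfl⟩ := hg; exact hgen k x hx
  | inv_mem g hg => obtain ⟨k, rfl⟩ := hg; simpa [twinGen_inv] using hgen k x hx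
  | one => simpa using hx
  | mul g h _ _ ihg ihh => rw [map_mul]; exact ihg (ihh hx)

/-- If the images of the generators commute in G/N, then G/N is abelian. -/
theorem commutator_le_of_generators {G : Type*} [Group G] {s : Set G}
    (hs : Subgroup.closure s = ⊤) (N : Subgroup G) [N.Normal]
    (h : ∀ a ∈ s, ∀ b ∈ s, ⁅a, b⁆ ∈ N) : commutator G ≤ N := by
  have hc : ∀ a b : G, Commute (a : G ⧸ N) (b : G ⧸ N) := by
    intro a b
    have ha : a ∈ Subgroup.closure s := hs ▸ Subgroup.mem_top a
    have hb : b ∈ Subgroup.closure s := hs ▸ Subgroup.mem_top b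
    induction ha, hb using Subgroup.closure_induction₂ with
    | mem a b ha hb =>
      rw [← commutatorElement_eq_one_iff_commute]
      exact (QuotientGroup.eq_one_iff _).2 (h a ha b hb)
    | one_left b _ => exact Commute.one_left _
    | one_right a _ => exact Commute.one_right _
    | mul_left a b c _ _ _ h1 h2 => exact h1.mul_left h2
    | mul_right a b c _ _ _ h1 h2 => exact h1.mul_right h2
    | inv_left a b _ _ h => exact h.inv_left
    | inv_right a b _ _ h => exact h.inv_right
  rw [commutator_def, Subgroup.commutator_le]
  intro a _ b _
  exact (QuotientGroup.eq_one_iff _).1 (commutatorElement_eq_one_iff_commute.2 (hc a b))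

theorem closure_twinB (n : ℕ) : Subgroup.closure (Set.range (twinB n)) = ⊤ := by
  set S := Subgroup.closure (Set.range (twinB n)) with hS
  have hN : (derivedPreimage S).Normal := by
    refine ⟨fun x hx g => ?_⟩
    obtain ⟨hx, hxS⟩ := mem_derivedPreimage.1 hx
    exact mem_derivedPreimage.2 ⟨Subgroup.Normal.conj_mem inferInstance x hx g,
      conj_mem_closure_twinB n g hxS⟩
  have hadj : ∀ i j : TwinIndex n, i.1 = j.1 + 1 →
      ⁅twinGen n i, twinGen n j⁆ ∈ derivedPreimage S := by
    rintro ⟨i, hi⟩ ⟨j, hj⟩ h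
    obtain rfl : i = j + 1 := h
    have : ⁅twinGen n (j + 1), twinGen n j⁆ = twinBetaZero n j := by
      rw [commutatorElement_def, twinGen_inv, twinGen_inv, twinBetaZero]
    change ⁅twinGen n (j + 1), twinGen n j⁆ ∈ _
    rw [this]
    exact mem_derivedPreimage.2 ⟨_, twinB0_mem (j := j) (by lia)⟩
  have hle : commutator (TwinGroup n) ≤ derivedPreimage S := by
    refine commutator_le_of_generators (twin_closure n) _ ?_
    rintro _ ⟨i, rfl⟩ _ ⟨j, rfl⟩
    obtain h | h | h | h : i = j ∨ i.1 = j.1 + 1 ∨ j.1 = i.1 + 1 ∨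
        (i.1 + 2 ≤ j.1 ∨ j.1 + 2 ≤ i.1) := by
      rw [Subtype.ext_iff]; lia
    · subst h
      rw [commutatorElement_self]
      exact one_mem _
    · exact hadj i j h
    · rw [← commutatorElement_inv]
      exact inv_mem (hadj j i h)
    · rw [commutatorElement_eq_one_iff_commute.2 (twinGen_comm h)]
      exact one_mem _
  rw [eq_top_iff]
  rintro x -
  induction x using QuotientGroup.induction_on with
  | H x => exact (mem_derivedPreimage.1 (hle x.2)).2

/-! ### Motions of the integer line -/

/-- The action of the units `±1` on the integers. -/
def lineAction : ℤˣ →* MulAut (Multiplicative ℤ) where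
  toFun u :=
    { toFun := fun v => Multiplicative.ofAdd ((u : ℤ) * v.toAdd)
      invFun := fun v => Multiplicative.ofAdd ((u : ℤ) * v.toAdd)
      left_inv := fun v => congrArg Multiplicative.ofAdd
        (show (u : ℤ) * (u * v.toAdd) = v.toAdd by simp [← mul_assoc])
      right_inv := fun v => congrArg Multiplicative.ofAdd
        (show (u : ℤ) * (u * v.toAdd) = v.toAdd by simp [← mul_assoc])
      map_mul' := fun v w => congrArg Multiplicative.ofAdd (mul_add (u : ℤ) v.toAdd w.toAdd) }
  map_one' := by
    ext v : 1
    exact congrArg Multiplicative.ofAdd (one_mul v.toAdd)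
  map_mul' u w := by
    ext v : 1
    exact congrArg Multiplicative.ofAdd (mul_assoc (u : ℤ) w v.toAdd)

theorem toAdd_lineAction (u : ℤˣ) (v : Multiplicative ℤ) :
    (lineAction u v).toAdd = (u : ℤ) * v.toAdd := rfl

/-- The group `ℤ ⋊ {±1}` of motions of the integer line. -/
abbrev LineMotion : Type := Multiplicative ℤ ⋊[lineAction] ℤˣ

/-- The reflection `x ↦ t - x`. -/
def lineReflection (t : ℤ) : LineMotion := ⟨Multiplicative.ofAdd t, -1⟩

/-- The images of the generators under the homomorphisms from `T_n` to the motions of the line. -/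
def twinLineGen {n : ℕ} : TwinBasisIndex n → ℕ → LineMotion
  | Sum.inl j, k => if k = j.1 then lineReflection 0 else if k = j.1 + 1 then lineReflection 1 else 1
  -- The commuting generators s_{j-1} and s_{j+1} get the same reflection; distinct reflections of
  -- the line do not commute.
  | Sum.inr j, k => if k + 1 = j.1 ∨ k = j.1 + 1 then lineReflection 0
      else if k = j.1 then lineReflection 1 else 1

theorem lineReflection_mul_self (t : ℤ) : lineReflection t * lineReflection t = 1 := by
  refine SemidirectProduct.ext ?_ (by simp [lineReflection])
  exact congrArg Multiplicative.ofAdd (show t + (-1) * t = 0 by ring)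

/-- The homomorphisms from `T_n` to the motions of the line. -/
def twinLine (n : ℕ) (i : TwinBasisIndex n) : TwinGroup n →* LineMotion :=
  twinLift n (twinLineGen i)
    (by
      intro k
      rcases i with j | j <;> simp only [twinLineGen] <;> split_ifs <;>
        exact lineReflection_mul_self _)
    (by
      intro k l h
      rcases i with j | j <;> simp only [twinLineGen] <;> split_ifs <;>
        first | exact Commute.refl _ | exact Commute.one_left _ | exact Commute.one_right _ | lia)

theorem twinLine_gen {n : ℕ} (i : TwinBasisIndex n) (k : ℕ) :
    twinLine n i (twinGen n k) = twinLineGen i k := by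
  rw [twinLine, twinLift_gen, ite_eq_left_iff]
  -- Outside 1 ≤ k < n the lift gives 1; the bounds on j ensure that the prescribed image is 1 there
  -- too.
  intro h
  rcases i with ⟨j, hj⟩ | ⟨j, hj⟩ <;> simp only [twinLineGen] <;> split_ifs <;>
    first | rfl | (exfalso; lia)

/-- The group `ℤˣ` is abelian, so T_n' acts by translations; this makes the translation part
additive on T_n'. -/
theorem twinLine_right {n : ℕ} (i : TwinBasisIndex n) {x : TwinGroup n}
    (hx : x ∈ commutator (TwinGroup n)) : (twinLine n i x).right = 1 :=
  Abelianization.commutator_subset_ker (SemidirectProduct.rightHom.comp (twinLine n i)) hx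

/-- The translation part of `twinLine`, on `T_n' / T_n''`. -/
def twinCoord (n : ℕ) (i : TwinBasisIndex n) : TwinDerivedMod n →* Multiplicative ℤ :=
  Abelianization.lift
    { toFun := fun x => (twinLine n i x).left
      map_one' := by simp
      map_mul' := fun x y => by simp [twinLine_right i x.2] }

theorem twinCoord_of {n : ℕ} (i : TwinBasisIndex n) (x : commutator (TwinGroup n)) :
    twinCoord n i (Abelianization.of x) = (twinLine n i x).left := rfl

/-- Conjugating a translation of the line by a motion multiplies it by the sign of that motion. This
diagonalizes the holonomy. -/
theorem twinCoord_conj {n : ℕ} (i : TwinBasisIndex n) (g : TwinGroup n) (x : TwinDerivedMod n) :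
    (twinCoord n i (conjDerived _ g x)).toAdd =
      ((twinLine n i g).right : ℤ) * (twinCoord n i x).toAdd := by
  induction x using QuotientGroup.induction_on with
  | H x =>
    change (twinCoord n i (conjDerived _ g (Abelianization.of x))).toAdd =
      ((twinLine n i g).right : ℤ) * (twinCoord n i (Abelianization.of x)).toAdd
    rw [conjDerived_of, twinCoord_of, twinCoord_of]
    simp [toAdd_lineAction, twinLine_right i x.2, ← mul_assoc]

/-- The product r₁r₀ is translation by 1 and β₀(j) maps to its square, whence the value 2. For any
other index at most one reflection is involved, and it cancels. -/
theorem twinCoord_inl_twinB0 {n : ℕ} (i : {j : ℕ // 1 ≤ j ∧ j + 2 ≤ n}) (j : ℕ) :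
    (twinCoord n (Sum.inl i) (twinB0 n j)).toAdd = if j = i.1 then 2 else 0 := by
  rw [twinB0, twinCoord_of]
  simp only [twinBetaZero, map_mul, twinLine_gen, twinLineGen]
  split_ifs <;> first | rfl | (exfalso; lia)

theorem twinCoord_inl_twinB1 {n : ℕ} (i : {j : ℕ // 1 ≤ j ∧ j + 2 ≤ n}) (j : ℕ) (hj : 2 ≤ j) :
    (twinCoord n (Sum.inl i) (twinB1 n j)).toAdd = if j = i.1 then 2 else 0 := by
  rw [← conj_twinB0_pred, twinCoord_conj, twinCoord_inl_twinB0, twinLine_gen]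
  split_ifs with h
  · simp only [twinLineGen]
    split_ifs <;> first | rfl | (exfalso; lia)
  · simp

/-- For j = i the two reflections occur in the order r₀r₁, translation by -1; for j + 1 = i in the
order r₁r₀. In all other cases only r₀ or 1 occurs, and the word cancels. -/
theorem twinCoord_inr_twinB0 {n : ℕ} (i : {j : ℕ // 2 ≤ j ∧ j + 2 ≤ n}) (j : ℕ) :
    (twinCoord n (Sum.inr i) (twinB0 n j)).toAdd =
      if j = i.1 then -2 else if j + 1 = i.1 then 2 else 0 := by
  rw [twinB0, twinCoord_of]
  simp only [twinBetaZero, map_mul, twinLine_gen, twinLineGen]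
  split_ifs <;> first | rfl | (exfalso; lia)

theorem twinCoord_inr_twinB1 {n : ℕ} (i : {j : ℕ // 2 ≤ j ∧ j + 2 ≤ n}) (j : ℕ) (hj : 2 ≤ j) :
    (twinCoord n (Sum.inr i) (twinB1 n j)).toAdd =
      if j = i.1 then 2 else if j + 1 = i.1 then 2 else 0 := by
  rw [← conj_twinB0_pred, twinCoord_conj, twinCoord_inr_twinB0, twinLine_gen]
  simp only [twinLineGen]
  split_ifs <;> first | rfl | (exfalso; lia)

/-! ### The basis of `T_n' / T_n''` -/

instance fintypeBounded (a n : ℕ) : Fintype {j : ℕ // a ≤ j ∧ j + 2 ≤ n} :=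
  Fintype.subtype ((Finset.range n).filter fun j => a ≤ j ∧ j + 2 ≤ n) fun j => by
    simp only [Finset.mem_filter, Finset.mem_range]; lia

theorem card_bounded (a n : ℕ) : Fintype.card {j : ℕ // a ≤ j ∧ j + 2 ≤ n} = n - 1 - a := by
  have h : ((Finset.range n).filter fun j => a ≤ j ∧ j + 2 ≤ n) = Finset.Ico a (n - 1) := by
    ext j
    simp only [Finset.mem_filter, Finset.mem_range, Finset.mem_Ico]; lia
  rw [← Nat.card_Ico, ← h]
  exact Fintype.card_of_subtype _ fun j => by
    simp only [Finset.mem_filter, Finset.mem_range]; lia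

theorem card_twinBasisIndex {n : ℕ} (hn : 3 ≤ n) : Fintype.card (TwinBasisIndex n) = 2 * n - 5 := by
  rw [Fintype.card_sum, card_bounded, card_bounded]
  lia

/-- `twinCoord` as a linear form. -/
def twinForm (n : ℕ) (i : TwinBasisIndex n) : Additive (TwinDerivedMod n) →ₗ[ℤ] ℤ :=
  (MonoidHom.toAdditiveLeft (twinCoord n i)).toIntLinearMap

theorem twinForm_ofMul {n : ℕ} (i : TwinBasisIndex n) (x : TwinDerivedMod n) :
    twinForm n i (Additive.ofMul x) = (twinCoord n i x).toAdd := rfl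

/-- Four times the coordinate forms of the family `twinB`. -/
def twinDual (n : ℕ) : TwinBasisIndex n → Additive (TwinDerivedMod n) →ₗ[ℤ] ℤ
  | Sum.inl j =>
    -- The combinations X_j - Y_j + X_{j-1} here and X_j + Y_j - X_{j-1} below invert, up to the
    -- factor 4, the table of values ±2 computed above. For j = 1 there is neither Y_1 nor X_0, and
    -- X_1 is 2 on β₀(1) and 0 on the rest of the family, so doubling suffices.
    if h : 2 ≤ j.1 then
      twinForm n (Sum.inl j) - twinForm n (Sum.inr ⟨j, h, j.2.2⟩) +
        twinForm n (Sum.inl ⟨j - 1, by lia, by lia⟩)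
    else 2 • twinForm n (Sum.inl j)
  | Sum.inr j => twinForm n (Sum.inl ⟨j, by lia, j.2.2⟩) + twinForm n (Sum.inr j) -
      twinForm n (Sum.inl ⟨j - 1, by lia, by lia⟩)

theorem twinDual_twinB {n : ℕ} (i j : TwinBasisIndex n) :
    twinDual n i (Additive.ofMul (twinB n j)) = (Pi.single j 4 : TwinBasisIndex n → ℤ) i := by
  rw [Pi.single_apply]
  rcases i with ⟨i, hi⟩ | ⟨i, hi⟩ <;> rcases j with ⟨j, hj⟩ | ⟨j, hj⟩ <;>
    simp only [twinDual, twinB, Sum.elim_inl, Sum.elim_inr, Sum.inl.injEq, Sum.inr.injEq,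
      Subtype.mk.injEq, reduceCtorEq, if_false]
  · split_ifs with h1 h2 h2 <;>
      simp only [LinearMap.add_apply, LinearMap.sub_apply, LinearMap.smul_apply, twinForm_ofMul,
        twinCoord_inl_twinB0, twinCoord_inr_twinB0] <;> split_ifs <;> first | rfl | (exfalso; lia)
  · split_ifs with h1 <;>
      simp only [LinearMap.add_apply, LinearMap.sub_apply, LinearMap.smul_apply, twinForm_ofMul,
        twinCoord_inl_twinB1 _ _ hj.1, twinCoord_inr_twinB1 _ _ hj.1] <;> split_ifs <;>
      first | rfl | (exfalso; lia)
  · simp only [LinearMap.add_apply, LinearMap.sub_apply, twinForm_ofMul,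
      twinCoord_inl_twinB0, twinCoord_inr_twinB0]
    split_ifs <;> first | rfl | (exfalso; lia)
  · simp only [LinearMap.add_apply, LinearMap.sub_apply, twinForm_ofMul,
      twinCoord_inl_twinB1 _ _ hj.1, twinCoord_inr_twinB1 _ _ hj.1]
    split_ifs <;> first | rfl | (exfalso; lia)

theorem linearIndependent_twinB (n : ℕ) :
    LinearIndependent ℤ (fun i => Additive.ofMul (twinB n i)) := by
  refine LinearIndependent.of_comp (LinearMap.pi (twinDual n)) ?_
  have h : (LinearMap.pi (twinDual n)) ∘ (fun i => Additive.ofMul (twinB n i)) =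
      fun i => Pi.single i (4 : ℤ) := by
    funext j
    funext i
    exact twinDual_twinB i j
  rw [h]
  exact Pi.linearIndependent_single_of_ne_zero (fun _ => by norm_num)

theorem span_twinB (n : ℕ) :
    ⊤ ≤ Submodule.span ℤ (Set.range fun i => Additive.ofMul (twinB n i)) := by
  rintro x -
  have hx : x.toMul ∈ Subgroup.closure (Set.range (twinB n)) := by
    rw [closure_twinB]; trivial
  suffices h : ∀ y ∈ Subgroup.closure (Set.range (twinB n)),
      Additive.ofMul y ∈ Submodule.span ℤ (Set.range fun i => Additive.ofMul (twinB n i)) from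
    h _ hx
  intro y hy
  induction hy using Subgroup.closure_induction with
  | mem y hy => obtain ⟨i, rfl⟩ := hy; exact Submodule.subset_span ⟨i, rfl⟩
  | one => exact Submodule.zero_mem _
  | mul y z _ _ hy hz => exact Submodule.add_mem _ hy hz
  | inv y _ hy => exact Submodule.neg_mem _ hy

/-- The basis of `T_n' / T_n''` given by the classes `β₀(j)` and `β₁(j)`. -/
noncomputable def twinBasis (n : ℕ) :
    Module.Basis (TwinBasisIndex n) ℤ (Additive (TwinDerivedMod n)) :=
  Module.Basis.mk (linearIndependent_twinB n) (span_twinB n)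

theorem twinBasis_apply {n : ℕ} (i : TwinBasisIndex n) :
    twinBasis n i = Additive.ofMul (twinB n i) := by
  rw [twinBasis, Module.Basis.mk_apply]

theorem twinDual_eq {n : ℕ} (i : TwinBasisIndex n) : twinDual n i = 4 • (twinBasis n).coord i := by
  refine (twinBasis n).ext fun j => ?_
  rw [twinBasis_apply, twinDual_twinB, ← twinBasis_apply]
  simp [Pi.single_apply, Finsupp.single_apply, eq_comm]

/-- The forms X_j, Y_j separate points: if all vanish, so does four times every coordinate in the
basis, and ℤ is torsion-free. -/
theorem eq_one_of_twinCoord {n : ℕ} {x : TwinDerivedMod n} (h : ∀ i, twinCoord n i x = 1) :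
    x = 1 := by
  have hz : ∀ i, twinForm n i (Additive.ofMul x) = 0 := fun i => by
    rw [twinForm_ofMul, h, toAdd_one]
  have hd : ∀ i, twinDual n i (Additive.ofMul x) = 0 := by
    rintro (i | i) <;> simp only [twinDual]
    · split_ifs <;> simp [hz]
    · simp [hz]
  have : Additive.ofMul x = 0 := by
    refine (twinBasis n).ext_elem fun i => ?_
    have := hd i
    rw [twinDual_eq] at this
    simpa using this
  exact this

theorem exists_twinCoord_eq_single {n : ℕ} (i : TwinBasisIndex n) :
    ∃ x : Additive (TwinDerivedMod n), ∀ k, twinForm n k x = (Pi.single i 4 : _ → ℤ) k := by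
  have hr : ∀ j : {j : ℕ // 2 ≤ j ∧ j + 2 ≤ n}, ∃ x : Additive (TwinDerivedMod n),
      ∀ k, twinForm n k x = (Pi.single (Sum.inr j) 4 : _ → ℤ) k := by
    rintro ⟨j, hj⟩
    -- β₁(j) and β₀(j) agree in every coordinate except Y_j, where they are 2 and -2.
    refine ⟨Additive.ofMul (twinB1 n j) - Additive.ofMul (twinB0 n j), ?_⟩
    rintro (⟨k, hk⟩ | ⟨k, hk⟩) <;>
      simp only [map_sub, twinForm_ofMul, twinCoord_inl_twinB0, twinCoord_inr_twinB0,
        twinCoord_inl_twinB1 _ _ hj.1, twinCoord_inr_twinB1 _ _ hj.1, Pi.single_apply,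
        Sum.inr.injEq, Subtype.mk.injEq, reduceCtorEq, if_false] <;> split_ifs <;>
      first | rfl | (exfalso; lia)
  rcases i with ⟨j, hj⟩ | j
  -- The sum β₁(j) + β₀(j), or 2β₀(1) when j = 1, has value 4 at X_j and at Y_{j+1} and 0 elsewhere.
  -- The unwanted Y_{j+1} is then removed with the previous case; it does not exist when j = n - 2.
  · have hy : ∃ y : Additive (TwinDerivedMod n), ∀ k, twinForm n k y =
        Sum.elim (fun k => if k.1 = j then 4 else 0) (fun k => if k.1 = j + 1 then 4 else 0) k := by
      by_cases h2 : 2 ≤ j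
      · refine ⟨Additive.ofMul (twinB1 n j) + Additive.ofMul (twinB0 n j), ?_⟩
        rintro (⟨k, hk⟩ | ⟨k, hk⟩) <;>
          simp only [map_add, twinForm_ofMul, twinCoord_inl_twinB0, twinCoord_inr_twinB0,
            twinCoord_inl_twinB1 _ _ h2, twinCoord_inr_twinB1 _ _ h2, Sum.elim_inl,
            Sum.elim_inr] <;> split_ifs <;> first | rfl | (exfalso; lia)
      · refine ⟨(2 : ℤ) • Additive.ofMul (twinB0 n j), ?_⟩
        rintro (⟨k, hk⟩ | ⟨k, hk⟩) <;>
          simp only [map_smul, twinForm_ofMul, twinCoord_inl_twinB0, twinCoord_inr_twinB0,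
            Sum.elim_inl, Sum.elim_inr] <;> split_ifs <;> first | rfl | (exfalso; lia)
    obtain ⟨y, hy⟩ := hy
    by_cases h : j + 3 ≤ n
    · obtain ⟨x, hx⟩ := hr ⟨j + 1, by lia, by lia⟩
      refine ⟨y - x, ?_⟩
      rintro (⟨k, hk⟩ | ⟨k, hk⟩) <;>
        simp only [map_sub, hy, hx, Pi.single_apply, Sum.elim_inl, Sum.elim_inr,
          Sum.inl.injEq, Sum.inr.injEq, Subtype.mk.injEq, reduceCtorEq, if_false] <;>
        split_ifs <;> rfl
    · refine ⟨y, ?_⟩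
      rintro (⟨k, hk⟩ | ⟨k, hk⟩) <;>
        simp only [hy, Pi.single_apply, Sum.elim_inl, Sum.elim_inr,
          Sum.inl.injEq, Subtype.mk.injEq, reduceCtorEq, if_false]
      split_ifs <;> first | rfl | (exfalso; lia)
  · exact hr j

theorem exists_twinForm_eq {n : ℕ} (m : TwinBasisIndex n → ℤ) :
    ∃ x : Additive (TwinDerivedMod n), ∀ k, twinForm n k x = 4 * m k := by
  choose x hx using exists_twinCoord_eq_single (n := n)
  refine ⟨∑ i, m i • x i, fun k => ?_⟩
  simp only [map_sum, map_smul, hx, Pi.single_apply]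
  simp [mul_comm]

/-! ### The abelianization of `T_n` and the quotient by `T_n''` -/

instance fintypeTwinIndex (n : ℕ) : Fintype (TwinIndex n) :=
  Fintype.subtype ((Finset.range n).filter fun k => 1 ≤ k ∧ k < n) fun k => by
    simp only [Finset.mem_filter, Finset.mem_range]; lia

theorem elemAb_mul_self {n : ℕ} (v : TwinElemAb n) : v * v = 1 :=
  Multiplicative.toAdd.injective (funext fun k => CharTwo.add_self_eq_zero (v.toAdd k))

/-- The homomorphism `T_n → ℤ₂^{n-1}` sending `s_k` to `a_k`. -/
def twinParity (n : ℕ) : TwinGroup n →* TwinElemAb n :=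
  twinLift n (fun k => if h : 1 ≤ k ∧ k < n then twinA n ⟨k, h⟩ else 1)
    (fun _ => elemAb_mul_self _) (fun _ _ _ => Commute.all _ _)

theorem twinParity_gen {n : ℕ} (k : TwinIndex n) : twinParity n (twinGen n k) = twinA n k := by
  rw [twinParity, twinLift_gen, if_pos k.2, dif_pos k.2]

theorem ofAdd_eq_prod {n : ℕ} (v : TwinIndex n → ZMod 2) :
    Multiplicative.ofAdd v = ∏ k, twinA n k ^ (v k).val := by
  apply Multiplicative.toAdd.injective
  rw [toAdd_prod]
  funext j
  simp only [toAdd_pow, twinA, toAdd_ofAdd, Finset.sum_apply, Pi.smul_apply, Pi.single_apply]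
  simp

theorem twinParity_surjective (n : ℕ) : Function.Surjective (twinParity n) := by
  intro v
  change v ∈ (twinParity n).range
  have := ofAdd_eq_prod v.toAdd
  rw [ofAdd_toAdd] at this
  rw [this]
  exact Subgroup.prod_mem _ fun k _ =>
    Subgroup.pow_mem _ (MonoidHom.mem_range.2 ⟨twinGen n k, twinParity_gen k⟩) _

theorem abelianization_mul_self {n : ℕ} (x : Abelianization (TwinGroup n)) : x * x = 1 := by
  induction x using QuotientGroup.induction_on with
  | H x =>
    have hx : x ∈ Subgroup.closure (Set.range fun k : TwinIndex n => twinGen n k) := by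
      rw [twin_closure]; trivial
    change Abelianization.of x * Abelianization.of x = 1
    induction hx using Subgroup.closure_induction with
    | mem x hx =>
      obtain ⟨k, rfl⟩ := hx
      rw [← map_mul]
      simp [twinGen_mul_self]
    | one => simp
    | mul x y _ _ hx hy => rw [map_mul, mul_mul_mul_comm, hx, hy, one_mul]
    | inv x _ hx => rw [map_inv, ← mul_inv, hx, inv_one]

/-- The inverse of the isomorphism from the abelianization of `T_n` to `ℤ₂^{n-1}`. -/
noncomputable def twinParityInv (n : ℕ) : TwinElemAb n →* Abelianization (TwinGroup n) :=
  letI : Module (ZMod 2) (Additive (Abelianization (TwinGroup n))) :=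
    AddCommGroup.zmodModule fun x => by
      rw [two_nsmul]; exact abelianization_mul_self (n := n) x.toMul
  AddMonoidHom.toMultiplicativeLeft
    (Fintype.linearCombination (ZMod 2)
      (fun k : TwinIndex n => Additive.ofMul (Abelianization.of (twinGen n k)))).toAddMonoidHom

theorem twinParityInv_comp (n : ℕ) : (twinParityInv n).comp (twinParity n) = Abelianization.of := by
  refine twin_hom_ext fun k => ?_
  rw [MonoidHom.comp_apply, twinParity_gen]
  let _ : Module (ZMod 2) (Additive (Abelianization (TwinGroup n))) :=
    AddCommGroup.zmodModule fun x => by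
      rw [two_nsmul]; exact abelianization_mul_self (n := n) x.toMul
  have h := Fintype.linearCombination_apply_single (ZMod 2)
    (fun k : TwinIndex n => Additive.ofMul (Abelianization.of (twinGen n k))) k 1
  rw [one_smul] at h
  exact h

/-- The abelianization map factors through `twinParity`, because the abelianization is generated by
commuting involutions and is thus a quotient of ℤ₂^{n-1}. -/
theorem ker_twinParity (n : ℕ) : (twinParity n).ker = commutator (TwinGroup n) := by
  apply le_antisymm
  · intro x hx
    have h := DFunLike.congr_fun (twinParityInv_comp n) x
    rw [MonoidHom.comp_apply, MonoidHom.mem_ker.1 hx, map_one] at h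
    exact (QuotientGroup.eq_one_iff x).1 h.symm
  · exact Abelianization.commutator_subset_ker _

/-- This links the two descriptions of T_n'': as a subgroup of T_n, and as the kernel of the
abelianization of T_n'. -/
theorem mem_derivedSeries_two_iff {G : Type*} [Group G] {g : G} :
    g ∈ derivedSeries G 2 ↔
      ∃ h : g ∈ commutator G, (Abelianization.of ⟨g, h⟩ : Abelianization (commutator G)) = 1 := by
  have h2 : derivedSeries G 2 = (commutator (commutator G)).map (commutator G).subtype := by
    rw [commutator_def (commutator G), Subgroup.map_commutator, ← MonoidHom.range_eq_map,
      Subgroup.range_subtype]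
    rfl
  rw [h2]
  constructor
  · rintro ⟨x, hx, rfl⟩
    exact ⟨x.2, (QuotientGroup.eq_one_iff x).2 hx⟩
  · rintro ⟨h, hx⟩
    exact ⟨⟨g, h⟩, (QuotientGroup.eq_one_iff _).1 hx, rfl⟩

theorem twinInclusion_injective (n : ℕ) : Function.Injective (twinInclusion n) := by
  rw [injective_iff_map_eq_one]
  intro x hx
  induction x using QuotientGroup.induction_on with
  | H x => exact (mem_derivedSeries_two_iff.1 ((QuotientGroup.eq_one_iff (x : TwinGroup n)).1 hx)).2

/-- The projection `T_n / T_n'' → ℤ₂^{n-1}`. -/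
def twinProj (n : ℕ) : TwinModSecond n →* TwinElemAb n :=
  QuotientGroup.lift _ (twinParity n) fun x hx => by
    obtain ⟨h, -⟩ := mem_derivedSeries_two_iff.1 hx
    rw [← ker_twinParity] at h
    exact h

theorem twinProj_mk {n : ℕ} (x : TwinGroup n) : twinProj n x = twinParity n x := rfl

theorem range_twinInclusion (n : ℕ) : (twinInclusion n).range = (twinProj n).ker := by
  ext z
  induction z using QuotientGroup.induction_on with
  | H z =>
    rw [MonoidHom.mem_ker, twinProj_mk, ← MonoidHom.mem_ker, ker_twinParity]
    constructor
    · rintro ⟨x, hx⟩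
      induction x using QuotientGroup.induction_on with
      | H x =>
        have h : (x : TwinGroup n)⁻¹ * z ∈ derivedSeries (TwinGroup n) 2 := QuotientGroup.eq.1 hx
        obtain ⟨h, -⟩ := mem_derivedSeries_two_iff.1 h
        simpa using mul_mem x.2 h
    · exact fun h => ⟨Abelianization.of ⟨z, h⟩, rfl⟩

/-! ### The holonomy representation -/

/-- The action of `ℤ₂^{n-1}` on `T_n' / T_n''`. -/
noncomputable def twinHolonomy (n : ℕ) : TwinElemAb n →* MulAut (TwinDerivedMod n) :=
  (twinParity n).liftOfSurjective (twinParity_surjective n)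
    ⟨conjDerived (TwinGroup n), fun x hx => by
      rw [ker_twinParity] at hx
      exact conjDerived_eq_one hx⟩

theorem twinHolonomy_parity {n : ℕ} (z : TwinGroup n) :
    twinHolonomy n (twinParity n z) = conjDerived _ z :=
  MonoidHom.liftOfRightInverse_comp_apply _ _ _ _ _

theorem twinHolonomy_twinA {n : ℕ} (k : TwinIndex n) :
    twinHolonomy n (twinA n k) = conjDerived _ (twinGen n k) := by
  rw [← twinParity_gen, twinHolonomy_parity]

theorem twinInclusion_holonomy {n : ℕ} (z : TwinModSecond n) (x : TwinDerivedMod n) :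
    twinInclusion n (twinHolonomy n (twinProj n z) x) = z * twinInclusion n x * z⁻¹ := by
  induction z using QuotientGroup.induction_on with
  | H z =>
    rw [twinProj_mk, twinHolonomy_parity]
    induction x using QuotientGroup.induction_on with
    | H x =>
      change ((MulAut.conjNormal z x : TwinGroup n) : TwinModSecond n) = _
      rw [MulAut.conjNormal_apply]
      rfl

/-- The isomorphism between `{±1}` and `ℤ₂`. -/
def unitParity : ℤˣ →* Multiplicative (ZMod 2) where
  toFun u := if u = 1 then 1 else Multiplicative.ofAdd 1
  map_one' := rfl
  map_mul' := by decide

/-- The reduction modulo `2` of the translation part of a motion of the line. -/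
def lineParity : LineMotion →* Multiplicative (ZMod 2) where
  toFun x := Multiplicative.ofAdd ((x.left.toAdd : ℤ) : ZMod 2)
  map_one' := by simp
  map_mul' x y := by
    rw [SemidirectProduct.mul_left, toAdd_mul, toAdd_lineAction, Int.cast_add, Int.cast_mul,
      ofAdd_add]
    congr 2
    -- The sign twisting the addition is invisible modulo 2.
    rcases Int.units_eq_one_or x.right with h | h <;> rw [h]
    · simp
    · rw [Units.val_neg, Units.val_one, Int.cast_neg, Int.cast_one,
        CharTwo.neg_eq, one_mul]

/-- The coordinates of `ℤ₂^{n-1}`. -/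
def elemAbCoord (n : ℕ) (k : TwinIndex n) : TwinElemAb n →* Multiplicative (ZMod 2) :=
  AddMonoidHom.toMultiplicative (Pi.evalAddMonoidHom _ k)

theorem elemAbCoord_twinA {n : ℕ} (k l : TwinIndex n) :
    elemAbCoord n k (twinA n l) = Multiplicative.ofAdd (if k.1 = l.1 then 1 else 0) := by
  change Multiplicative.ofAdd ((Pi.single l 1 : TwinIndex n → ZMod 2) k) = _
  rw [Pi.single_apply]
  simp only [Subtype.ext_iff]

theorem eq_one_of_elemAbCoord {n : ℕ} {v : TwinElemAb n} (h : ∀ k, elemAbCoord n k v = 1) :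
    v = 1 :=
  Multiplicative.toAdd.injective (funext h)

theorem unitParity_twinLine_inl {n : ℕ} (j : {j : ℕ // 1 ≤ j ∧ j + 2 ≤ n}) (z : TwinGroup n) :
    unitParity (twinLine n (Sum.inl j) z).right =
      elemAbCoord n ⟨j, by lia⟩ (twinParity n z) *
        elemAbCoord n ⟨j + 1, by lia⟩ (twinParity n z) := by
  have h : (unitParity.comp SemidirectProduct.rightHom).comp (twinLine n (Sum.inl j)) =
      (elemAbCoord n ⟨j, by lia⟩).comp (twinParity n) *
        (elemAbCoord n ⟨j + 1, by lia⟩).comp (twinParity n) := by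
    refine twin_hom_ext fun k => ?_
    simp only [MonoidHom.comp_apply, MonoidHom.mul_apply, twinParity_gen, elemAbCoord_twinA,
      twinLine_gen, twinLineGen]
    split_ifs <;> first | rfl | (exfalso; lia)
  exact DFunLike.congr_fun h z

theorem unitParity_twinLine_inr {n : ℕ} (j : {j : ℕ // 2 ≤ j ∧ j + 2 ≤ n}) (z : TwinGroup n) :
    unitParity (twinLine n (Sum.inr j) z).right =
      elemAbCoord n ⟨j - 1, by lia⟩ (twinParity n z) *
      elemAbCoord n ⟨j, by lia⟩ (twinParity n z) *
        elemAbCoord n ⟨j + 1, by lia⟩ (twinParity n z) := by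
  have h : (unitParity.comp SemidirectProduct.rightHom).comp (twinLine n (Sum.inr j)) =
      (elemAbCoord n ⟨j - 1, by lia⟩).comp (twinParity n) *
      (elemAbCoord n ⟨j, by lia⟩).comp (twinParity n) *
        (elemAbCoord n ⟨j + 1, by lia⟩).comp (twinParity n) := by
    refine twin_hom_ext fun k => ?_
    simp only [MonoidHom.comp_apply, MonoidHom.mul_apply, twinParity_gen, elemAbCoord_twinA,
      twinLine_gen, twinLineGen]
    split_ifs <;> first | rfl | (exfalso; lia)
  exact DFunLike.congr_fun h z

/-- Modulo 2 the translation part counts occurrences of s_{j+1}, the only generator sent to r₁. The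
signs alone do not recover the class in ℤ₂^{n-1} when n = 3. -/
theorem lineParity_twinLine_inl {n : ℕ} (j : {j : ℕ // 1 ≤ j ∧ j + 2 ≤ n}) (z : TwinGroup n) :
    lineParity (twinLine n (Sum.inl j) z) = elemAbCoord n ⟨j + 1, by lia⟩ (twinParity n z) := by
  have h : lineParity.comp (twinLine n (Sum.inl j)) =
      (elemAbCoord n ⟨j + 1, by lia⟩).comp (twinParity n) := by
    refine twin_hom_ext fun k => ?_
    simp only [MonoidHom.comp_apply, twinParity_gen, elemAbCoord_twinA,
      twinLine_gen, twinLineGen]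
    split_ifs <;> first | rfl | (exfalso; lia)
  exact DFunLike.congr_fun h z

theorem twinHolonomy_injective {n : ℕ} (hn : 4 ≤ n) : Function.Injective (twinHolonomy n) := by
  rw [injective_iff_map_eq_one]
  intro v hv
  obtain ⟨z, rfl⟩ := twinParity_surjective n v
  rw [twinHolonomy_parity] at hv
  -- All forms take the value 4 on a suitable x, so an element acting trivially must have sign 1 in
  -- each coordinate.
  have hs : ∀ i, (twinLine n i z).right = 1 := by
    intro i
    obtain ⟨x, hx⟩ := exists_twinForm_eq (n := n) 1
    have h := twinCoord_conj i z x.toMul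
    rw [hv, MulAut.one_apply, ← twinForm_ofMul, ofMul_toMul, hx] at h
    rcases Int.units_eq_one_or (twinLine n i z).right with h1 | h1
    · exact h1
    · rw [h1] at h
      norm_num at h
  have h1 := fun j => unitParity_twinLine_inl (n := n) j z
  have h2 := fun j => unitParity_twinLine_inr (n := n) j z
  simp only [hs, map_one] at h1 h2
  -- With ε_k the exponent of s_k modulo 2, the signs give ε_k + ε_{k+1} + ε_{k+2} = 0 and ε_{k+1} +
  -- ε_{k+2} = 0, hence ε_k = 0 for k ≤ n - 3. Equality of consecutive ε's carries this to the last
  -- two indices; n ≥ 4 provides the starting point.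
  have hlow : ∀ k (hk : 1 ≤ k ∧ k + 3 ≤ n), elemAbCoord n ⟨k, by lia⟩ (twinParity n z) = 1 := by
    intro k hk
    have h2' := h2 ⟨k + 1, by lia, by lia⟩
    have h1' := h1 ⟨k + 1, by lia, by lia⟩
    rw [mul_assoc, ← h1', mul_one] at h2'
    exact h2'.symm
  refine eq_one_of_elemAbCoord ?_
  have hstep : ∀ k (hk : 1 ≤ k ∧ k + 2 ≤ n), elemAbCoord n ⟨k, by lia⟩ (twinParity n z) = 1 →
      elemAbCoord n ⟨k + 1, by lia⟩ (twinParity n z) = 1 := by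
    intro k hk h
    have h1' := h1 ⟨k, hk⟩
    rw [h, one_mul] at h1'
    exact h1'.symm
  rintro ⟨k, hk⟩
  obtain h | rfl | rfl : k + 3 ≤ n ∨ n = k + 2 ∨ n = k + 1 := by lia
  · exact hlow k ⟨hk.1, h⟩
  · obtain ⟨l, rfl⟩ : ∃ l, k = l + 1 := ⟨k - 1, by lia⟩
    exact hstep l (by lia) (hlow l (by lia))
  · obtain ⟨l, rfl⟩ : ∃ l, k = l + 2 := ⟨k - 2, by lia⟩
    exact hstep (l + 1) (by lia) (hstep l (by lia) (hlow l (by lia)))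

/-- For n = 3 the only basis element is β₀(1), and both s_1 and s_2 invert it. -/
theorem twinHolonomy_not_injective : ¬ Function.Injective (twinHolonomy 3) := by
  intro h
  have key : twinHolonomy 3 (twinA 3 ⟨1, by norm_num⟩) =
      twinHolonomy 3 (twinA 3 ⟨2, by norm_num⟩) := by
    rw [twinHolonomy_twinA, twinHolonomy_twinA]
    ext x
    have hx : x ∈ Subgroup.closure (Set.range (twinB 3)) := by
      rw [closure_twinB]; trivial
    induction hx using Subgroup.closure_induction with
    | mem x hx =>
      obtain ⟨⟨j, hj⟩ | ⟨j, hj⟩, rfl⟩ := hx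
      · obtain rfl : j = 1 := by lia
        exact (conj_twinB0_self 3 1).trans (conj_twinB0_succ 3 1).symm
      · exfalso; lia
    | one => simp
    | mul x y _ _ hx hy => rw [map_mul, map_mul, hx, hy]
    | inv x _ hx => rw [map_inv, map_inv, hx]
  have h1 := congrArg (elemAbCoord 3 ⟨1, by norm_num⟩) (h key)
  rw [elemAbCoord_twinA, elemAbCoord_twinA] at h1
  exact absurd h1 (by decide)

/-- The translation parts modulo 2 kill the exponents of s_2, …, s_{n-1}, and the sign of X_1 then
kills that of s_1. So z lies in T_n', where the forms separate points modulo T_n''. -/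
theorem mem_derivedSeries_two_of_twinLine {n : ℕ} (hn : 3 ≤ n) {z : TwinGroup n}
    (h : ∀ i, twinLine n i z = 1) : z ∈ derivedSeries (TwinGroup n) 2 := by
  have hz : z ∈ commutator (TwinGroup n) := by
    rw [← ker_twinParity, MonoidHom.mem_ker]
    have hsucc : ∀ j (hj : 1 ≤ j ∧ j + 2 ≤ n),
        elemAbCoord n ⟨j + 1, by lia⟩ (twinParity n z) = 1 := by
      intro j hj
      rw [← lineParity_twinLine_inl ⟨j, hj⟩, h, map_one]
    refine eq_one_of_elemAbCoord ?_
    rintro ⟨k, hk⟩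
    by_cases h1 : k + 2 ≤ n
    · have := unitParity_twinLine_inl ⟨k, hk.1, h1⟩ z
      rw [hsucc k ⟨hk.1, h1⟩, h, SemidirectProduct.one_right, map_one, mul_one] at this
      exact this.symm
    · obtain ⟨l, rfl⟩ : ∃ l, k = l + 1 := ⟨k - 1, by lia⟩
      exact hsucc l (by lia)
  refine mem_derivedSeries_two_iff.2 ⟨hz, eq_one_of_twinCoord fun i => ?_⟩
  rw [twinCoord_of, h, SemidirectProduct.one_left]

theorem twinLine_eq_one {n : ℕ} (i : TwinBasisIndex n) {z : TwinGroup n}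
    (hz : z ∈ derivedSeries (TwinGroup n) 2) : twinLine n i z = 1 := by
  obtain ⟨h, h'⟩ := mem_derivedSeries_two_iff.1 hz
  refine SemidirectProduct.ext ?_ (twinLine_right i h)
  rw [← twinCoord_of i ⟨z, h⟩, h', map_one, SemidirectProduct.one_left]

/-! ### Crystallographic groups with diagonal holonomy -/

/-- The homomorphism from products of motions of the integer line to euclidean motions. -/
def productMotion (d : ℕ) : (Fin d → LineMotion) →* EuclideanMotion d where
  toFun g :=
    ⟨Multiplicative.ofAdd fun a => ((g a).left.toAdd : ℝ),
      ⟨Matrix.diagonal fun a => (((g a).right : ℤ) : ℝ), by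
        rw [Matrix.mem_orthogonalGroup_iff, Matrix.diagonal_transpose,
          Matrix.diagonal_mul_diagonal, ← Matrix.diagonal_one]
        congr 1
        funext a
        rcases Int.units_eq_one_or (g a).right with h | h <;> simp [h]⟩⟩
  map_one' := by
    refine SemidirectProduct.ext ?_ (Subtype.ext ?_)
    · refine congrArg Multiplicative.ofAdd (funext fun a => ?_)
      simp
    · simp
  map_mul' g h := by
    refine SemidirectProduct.ext ?_ (Subtype.ext ?_)
    · refine congrArg Multiplicative.ofAdd (funext fun a => ?_)
      simp [toAdd_lineAction, orthogonalAction, Matrix.mulVec_diagonal]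
    · simp [Matrix.diagonal_mul_diagonal]

theorem productMotion_left {d : ℕ} (g : Fin d → LineMotion) (a : Fin d) :
    (productMotion d g).left.toAdd a = ((g a).left.toAdd : ℝ) := rfl

theorem productMotion_right {d : ℕ} (g : Fin d → LineMotion) (a : Fin d) :
    (productMotion d g).right.1 a a = (((g a).right : ℤ) : ℝ) :=
  Matrix.diagonal_apply_eq _ _

theorem productMotion_injective (d : ℕ) : Function.Injective (productMotion d) := by
  intro g h hgh
  funext a
  refine SemidirectProduct.ext ?_ (Units.ext ?_)
  · have h1 := productMotion_left g a
    rw [hgh, productMotion_left] at h1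
    exact Multiplicative.toAdd.injective (Int.cast_injective h1).symm
  · have h1 := productMotion_right g a
    rw [hgh, productMotion_right] at h1
    exact (Int.cast_injective h1).symm

/-- An integer of absolute value below 1 is 0 and a positive sign is 1. These open conditions
isolate the identity and give discreteness. -/
theorem productMotion_eq_one {d : ℕ} {g : Fin d → LineMotion}
    (h1 : ∀ a, |(productMotion d g).left.toAdd a| < 1)
    (h2 : ∀ a, 0 < (productMotion d g).right.1 a a) : g = 1 := by
  funext a
  refine SemidirectProduct.ext ?_ ?_
  · have := h1 a
    rw [productMotion_left, ← Int.cast_abs] at this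
    exact Multiplicative.toAdd.injective (Int.abs_lt_one_iff.1 (by exact_mod_cast this))
  · have := h2 a
    rw [productMotion_right] at this
    rcases Int.units_eq_one_or (g a).right with h | h
    · exact h
    · rw [h] at this
      norm_num at this

theorem discreteTopology_range_productMotion {d : ℕ} {G : Type*} [Group G]
    (f : G →* (Fin d → LineMotion)) : DiscreteTopology ((productMotion d).comp f).range := by
  apply discreteTopology_of_isOpen_singleton_one
  let U : Set (EuclideanMotion d) :=
    ⋂ a, {g | |g.left.toAdd a| < 1} ∩ {g | 0 < g.right.1 a a}
  have hU : IsOpen U := by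
    refine isOpen_iInter_of_finite fun a => IsOpen.inter ?_ ?_
    · refine isOpen_lt (continuous_abs.comp ((continuous_apply a).comp
        (continuous_toAdd.comp (continuous_euclideanMotion_left d)))) continuous_const
    · exact isOpen_lt continuous_const ((continuous_subtype_val.comp
        (continuous_euclideanMotion_right d)).matrix_elem a a)
  convert hU.preimage (continuous_subtype_val (p := (· ∈ ((productMotion d).comp f).range)))
  ext ⟨_, g, rfl⟩
  rw [Set.mem_singleton_iff, Subtype.ext_iff]
  simp only [U, Set.mem_preimage, Set.mem_iInter, Set.mem_inter_iff, Set.mem_ofPred_eq]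
  constructor
  · intro h a
    change (productMotion d).comp f g = 1 at h
    rw [h]
    simp
  · intro h
    change productMotion d (f g) = 1
    rw [productMotion_eq_one (fun a => (h a).1) (fun a => (h a).2), map_one]

theorem isCompact_orthogonalGroup (d : ℕ) :
    IsCompact (Matrix.orthogonalGroup (Fin d) ℝ : Set (Matrix (Fin d) (Fin d) ℝ)) := by
  have hK : IsCompact (Set.univ.pi fun _ => Set.univ.pi fun _ => Set.Icc (-1) 1 :
      Set (Fin d → Fin d → ℝ)) :=
    isCompact_univ_pi fun _ => isCompact_univ_pi fun _ => isCompact_Icc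
  refine hK.of_isClosed_subset ?_ ?_
  · have h : (Matrix.orthogonalGroup (Fin d) ℝ : Set (Matrix (Fin d) (Fin d) ℝ)) =
        {A | A * A.transpose = 1} := by
      ext A
      exact Matrix.mem_orthogonalGroup_iff _ _
    rw [h]
    exact isClosed_eq (by fun_prop) continuous_const
  · intro A hA i _ j _
    exact abs_le.1 (entry_norm_bound_of_unitary hA i j)

/-- Write a motion as (Aw, A). Right multiplication by a translation t turns w into w + t, so modulo
the lattice 4ℤ^d every coset has a representative with w in the cube [0, 4]^d. The compact set [0,
4]^d × O(d) therefore maps onto the quotient. -/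
theorem compactSpace_quotient_euclideanMotion {d : ℕ} (Γ : Subgroup (EuclideanMotion d))
    (h : ∀ m : Fin d → ℤ,
      (SemidirectProduct.inl (Multiplicative.ofAdd fun a => 4 * (m a : ℝ)) : EuclideanMotion d) ∈ Γ) :
    CompactSpace (EuclideanMotion d ⧸ Γ) := by
  have hc : CompactSpace (Matrix.orthogonalGroup (Fin d) ℝ) :=
    isCompact_iff_compactSpace.1 (isCompact_orthogonalGroup d)
  have hB : IsCompact (Set.univ.pi fun _ => Set.Icc 0 4 : Set (Fin d → ℝ)) :=
    isCompact_univ_pi fun _ => isCompact_Icc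
  let F : (Fin d → ℝ) × Matrix.orthogonalGroup (Fin d) ℝ → EuclideanMotion d :=
    fun p => ⟨orthogonalAction d p.2 (Multiplicative.ofAdd p.1), p.2⟩
  have hF : Continuous F := by
    refine continuous_induced_rng.2 (Continuous.prodMk ?_ continuous_snd)
    exact (continuous_orthogonalAction d).comp
      (continuous_snd.prodMk (continuous_ofAdd.comp continuous_fst))
  have hK := (hB.prod (isCompact_univ (X := Matrix.orthogonalGroup (Fin d) ℝ))).image
    ((QuotientGroup.continuous_mk (N := Γ)).comp hF)
  refine ⟨hK.of_isClosed_subset isClosed_univ ?_⟩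
  rintro x -
  induction x using QuotientGroup.induction_on with
  | H g =>
    let w : Fin d → ℝ := (orthogonalAction d g.right⁻¹ g.left).toAdd
    refine ⟨(w + fun a => 4 * ((-⌊w a / 4⌋ : ℤ) : ℝ), g.right), ⟨fun a _ => ?_, trivial⟩, ?_⟩
    · have h1 := Int.floor_le (w a / 4)
      have h2 := Int.lt_floor_add_one (w a / 4)
      simp only [Pi.add_apply, Int.cast_neg]
      constructor <;> linarith
    · rw [← QuotientGroup.mk_mul_of_mem g (h fun a => -⌊w a / 4⌋)]
      refine congrArg QuotientGroup.mk (SemidirectProduct.ext ?_ (mul_one _).symm)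
      change orthogonalAction d g.right (Multiplicative.ofAdd w * Multiplicative.ofAdd _) =
        g.left * orthogonalAction d g.right _
      rw [map_mul]
      congr 1
      change orthogonalAction d g.right (orthogonalAction d g.right⁻¹ g.left) = g.left
      rw [← MulAut.mul_apply, ← map_mul, mul_inv_cancel, map_one, MulAut.one_apply]

theorem isCrystallographicGroup_of_lineMotion {d : ℕ} {G : Type*} [Group G]
    (f : G →* (Fin d → LineMotion)) (hf : Function.Injective f)
    (h : ∀ m : Fin d → ℤ, ∃ g, f g = fun a => SemidirectProduct.inl (Multiplicative.ofAdd (4 * m a))) :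
    IsCrystallographicGroup d G := by
  have hd := discreteTopology_range_productMotion f
  refine ⟨((productMotion d).comp f).range, hd, ⟨Subgroup.isClosed_of_discrete, ?_⟩,
    ⟨MonoidHom.ofInjective (f := (productMotion d).comp f)
      ((productMotion_injective d).comp hf)⟩⟩
  refine compactSpace_quotient_euclideanMotion _ fun m => ?_
  obtain ⟨g, hg⟩ := h m
  refine ⟨g, ?_⟩
  rw [MonoidHom.comp_apply, hg]
  refine SemidirectProduct.ext (congrArg Multiplicative.ofAdd (funext fun a => ?_))
    (Subtype.ext ?_)
  · exact (Int.cast_mul 4 (m a)).trans (by norm_num)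
  · exact (congrArg Matrix.diagonal (funext fun _ => show (((1 : ℤˣ) : ℤ) : ℝ) = 1 by simp)).trans
      Matrix.diagonal_one

/-! ### The structure of `T_n / T_n''` -/

/-- The homomorphism from `T_n / T_n''` to motions of the line induced by `twinLine`. -/
def twinModLine (n : ℕ) (i : TwinBasisIndex n) : TwinModSecond n →* LineMotion :=
  QuotientGroup.lift _ (twinLine n i) fun _ hz => twinLine_eq_one i hz

theorem isCrystallographicGroup_twinModSecond {n : ℕ} (hn : 3 ≤ n) :
    IsCrystallographicGroup (2 * n - 5) (TwinModSecond n) := by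
  let e : TwinBasisIndex n ≃ Fin (2 * n - 5) := Fintype.equivFinOfCardEq (card_twinBasisIndex hn)
  refine isCrystallographicGroup_of_lineMotion
    (MonoidHom.pi fun a => twinModLine n (e.symm a)) ?_ ?_
  · rw [injective_iff_map_eq_one]
    intro z hz
    induction z using QuotientGroup.induction_on with
    | H z =>
      refine (QuotientGroup.eq_one_iff z).2 (mem_derivedSeries_two_of_twinLine hn fun i => ?_)
      have := congrFun hz (e i)
      rwa [MonoidHom.pi_apply, e.symm_apply_apply] at this
  · intro m
    obtain ⟨x, hx⟩ := exists_twinForm_eq fun i => m (e i)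
    induction x using QuotientGroup.induction_on with
    | H x =>
      refine ⟨((x : TwinGroup n) : TwinModSecond n), funext fun a => ?_⟩
      refine SemidirectProduct.ext ?_ (twinLine_right _ x.2)
      have := hx (e.symm a)
      rw [e.apply_symm_apply] at this
      exact Multiplicative.toAdd.injective this

/-- `T_n' / T_n''` is free abelian of rank `2n - 5`. -/
noncomputable def twinDerivedEquiv {n : ℕ} (hn : 3 ≤ n) :
    TwinDerivedMod n ≃* Multiplicative (Fin (2 * n - 5) → ℤ) :=
  AddEquiv.toMultiplicativeRight
    ((twinBasis n).reindex (Fintype.equivFinOfCardEq (card_twinBasisIndex hn))).equivFun.toAddEquiv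

theorem twinDerivedMod_eq_one {n : ℕ} (hn : 3 ≤ n) {x : TwinDerivedMod n} (hx : IsOfFinOrder x) :
    x = 1 := by
  obtain ⟨m, hm, h⟩ := isOfFinOrder_iff_pow_eq_one.1 hx
  apply (twinDerivedEquiv hn).injective
  have h1 := congrArg (twinDerivedEquiv hn) h
  rw [map_pow, map_one] at h1
  rw [map_one]
  have h2 : m • (twinDerivedEquiv hn x).toAdd = 0 := h1
  exact Multiplicative.toAdd.injective ((smul_eq_zero.1 h2).resolve_left hm.ne')

theorem orderOf_twinModSecond {n : ℕ} (hn : 3 ≤ n) {g : TwinModSecond n} (hg : IsOfFinOrder g)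
    (h1 : g ≠ 1) : orderOf g = 2 := by
  refine orderOf_eq_prime ?_ h1
  -- The quotient ℤ₂^{n-1} has exponent 2, so the square falls into the free abelian kernel, where
  -- finite order forces triviality.
  have hmem : g ^ 2 ∈ (twinInclusion n).range := by
    rw [range_twinInclusion, MonoidHom.mem_ker, map_pow, pow_two, elemAb_mul_self]
  obtain ⟨x, hx⟩ := hmem
  have hfin : IsOfFinOrder x := by
    rw [← (twinInclusion_injective n).isOfFinOrder_iff, hx]
    exact hg.pow
  rw [← hx, twinDerivedMod_eq_one hn hfin, map_one]

theorem orderOf_twinGen {n : ℕ} (k : TwinIndex n) :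
    orderOf ((twinGen n k : TwinGroup n) : TwinModSecond n) = 2 := by
  refine orderOf_eq_prime ?_ fun h => ?_
  · rw [pow_two, ← QuotientGroup.mk_mul, twinGen_mul_self]
    rfl
  · have h' := congrArg (fun z => elemAbCoord n k (twinProj n z)) h
    simp only [twinProj_mk, twinParity_gen, elemAbCoord_twinA, map_one, if_true] at h'
    exact absurd h' (by decide)

theorem theorem4p9 (n : ℕ) (hn : 3 ≤ n) :
    -- the extension `1 → T_n'/T_n'' → T_n/T_n'' → ℤ₂^{n-1} → 1`
    (∃ π : TwinModSecond n →* TwinElemAb n,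
      (∀ k : TwinIndex n, π (QuotientGroup.mk (twinGen n k)) = twinA n k) ∧
      Function.Injective (twinInclusion n) ∧
      (twinInclusion n).range = π.ker ∧
      Function.Surjective π ∧
      -- its kernel is free abelian of rank `2n - 5`, on the classes of
      -- `β₀(j)`, `1 ≤ j ≤ n - 2`, and `β₁(j)`, `2 ≤ j ≤ n - 2`
      Nonempty (TwinDerivedMod n ≃* Multiplicative (Fin (2 * n - 5) → ℤ)) ∧
      (∃ b : Module.Basis ({j : ℕ // 1 ≤ j ∧ j + 2 ≤ n} ⊕ {j : ℕ // 2 ≤ j ∧ j + 2 ≤ n}) ℤ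
          (Additive (TwinDerivedMod n)),
        (∀ j, b (Sum.inl j) = Additive.ofMul (twinB0 n j)) ∧
        (∀ j, b (Sum.inr j) = Additive.ofMul (twinB1 n j))) ∧
      -- the holonomy representation
      ∃ Θ : TwinElemAb n →* MulAut (TwinDerivedMod n),
        (∀ (z : TwinModSecond n) (x : TwinDerivedMod n),
          twinInclusion n (Θ (π z) x) = z * twinInclusion n x * z⁻¹) ∧
        (Function.Injective Θ ↔ 4 ≤ n) ∧
        (∀ (k : TwinIndex n) (j : ℕ), 1 ≤ j → j + 2 ≤ n →
          Θ (twinA n k) (twinB0 n j) =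
            if j + 2 = k then twinB0 n (j + 1) * twinB0 n j * (twinB1 n (j + 1))⁻¹
            else if j + 1 = k ∨ j = k then (twinB0 n j)⁻¹
            else if j = k + 1 then twinB1 n j
            else twinB0 n j) ∧
        (∀ (k : TwinIndex n) (j : ℕ), 2 ≤ j → j + 2 ≤ n →
          Θ (twinA n k) (twinB1 n j) =
            if j + 2 = k then twinB0 n (j + 1) * twinB1 n j * (twinB1 n (j + 1))⁻¹
            else if j + 1 = k ∨ j = k then (twinB1 n j)⁻¹
            else if j = k + 1 then twinB0 n j
            else twinB1 n j)) ∧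
    IsCrystallographicGroup (2 * n - 5) (TwinModSecond n) ∧
    (¬ ∃ d : ℕ, IsBieberbachGroup d (TwinModSecond n)) ∧
    -- there is torsion, and it is only 2-torsion
    (∃ g : TwinModSecond n, orderOf g = 2) ∧
    (∀ g : TwinModSecond n, IsOfFinOrder g → g ≠ 1 → orderOf g = 2) := by
  refine ⟨⟨twinProj n, fun k => twinParity_gen k, twinInclusion_injective n,
    range_twinInclusion n, ?_, ⟨twinDerivedEquiv hn⟩,
    ⟨twinBasis n, fun j => twinBasis_apply _, fun j => twinBasis_apply _⟩,
    twinHolonomy n, twinInclusion_holonomy, ?_, ?_, ?_⟩,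
    isCrystallographicGroup_twinModSecond hn, ?_, ⟨_, orderOf_twinGen ⟨1, by lia⟩⟩,
    fun g => orderOf_twinModSecond hn⟩
  · intro v
    obtain ⟨z, rfl⟩ := twinParity_surjective n v
    exact ⟨z, rfl⟩
  · refine ⟨fun h => ?_, twinHolonomy_injective⟩
    by_contra h4
    obtain rfl : n = 3 := by lia
    exact twinHolonomy_not_injective h
  · intro k j _ _
    rw [twinHolonomy_twinA, conj_twinB0]
  · intro k j hj _
    rw [twinHolonomy_twinA, conj_twinB1 n k j hj]
  · rintro ⟨d, -, h⟩
    have h2 := orderOf_twinGen (n := n) ⟨1, by lia⟩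
    rw [h _ (orderOf_pos_iff.1 (two_pos.trans_eq h2.symm)), orderOf_one] at h2
    exact absurd h2 (by norm_num)
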